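/- Let $\epsilon\in\{0,\tfrac12\}$ and let $\mathfrak q_\epsilon$ be the complex Lie superalgebra with basis $\{L_m, H_m, G_r, C \mid m\in\mathbb Z,\ r\in\mathbb Z+\epsilon\}$, where $L_m,H_m,C$ are even and $G_r$ is odd, $C$ is central, and $$[L_m,L_n]=(n-m)L_{m+n}+\tfrac1{12}\delta_{m+n,0}(n^3-n)C,\qquad [H_m,H_n]=\tfrac13 m\,\delta_{m+n,0}C,\qquad [L_m,H_n]=nH_{m+n},$$ $$[L_m,G_r]=\left(r-\tfrac m2\right)G_{m+r},\qquad [H_m,G_r]=G_{m+r},\qquad [G_r,G_s]=0 .$$ Let $U(\mathfrak q_\epsilon)$ be its universal enveloping algebra, i.e. the quotient of the tensor algebra of $\mathfrak q_\epsilon$ by the two-sided ideal generated by all $xy-(-1)^{|x||y|}yx-[x,y]$ with $x,y\in\mathfrak q_\epsilon$ homogeneous. Then the center of $U(\mathfrak q_\epsilon)$ is $S(C)$, the polynomial algebra in $C$. Precisely: the element $C\in U(\mathfrak q_\epsilon)$ is transcendental over $\mathbb C$, and the subalgebra $\mathbb C[C]$ generated by it equals the center $\{z : zu=uz \text{ for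 all } u\}$ of $U(\mathfrak q_\epsilon)$. It also equals the supercenter of $U(\mathfrak q_\epsilon)$, i.e. the span of the homogeneous $z$ with $zu=(-1)^{|z||u|}uz$ for all homogeneous $u$. -/

import Mathlib

/-- A Lie superalgebra over a field `𝕜` on the vector space `V`: a `ZMod 2`-grading of `V` and a
bilinear bracket that respects it, with super skew-symmetry and the super Jacobi identity. -/
structure LieSuperalgebra (𝕜 : Type*) (V : Type*) [Field 𝕜] [AddCommGroup V] [Module 𝕜 V] where
  /-- the even part `gr 0` and the odd part `gr 1` -/
  gr : ZMod 2 → Submodule 𝕜 V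
  isInternal_gr : DirectSum.IsInternal gr
  /-- the bracket `[x, y]` -/
  bracket : V →ₗ[𝕜] V →ₗ[𝕜] V
  bracket_mem : ∀ (i j : ZMod 2) (x y : V), x ∈ gr i → y ∈ gr j → bracket x y ∈ gr (i + j)
  bracket_skew : ∀ (i j : ZMod 2) (x y : V), x ∈ gr i → y ∈ gr j →
    bracket x y = -((-1 : 𝕜) ^ (i.val * j.val) • bracket y x)
  bracket_jacobi : ∀ (i j k : ZMod 2) (x y z : V), x ∈ gr i → y ∈ gr j → z ∈ gr k →
    bracket x (bracket y z) =
      bracket (bracket x y) z + (-1 : 𝕜) ^ (i.val * j.val) • bracket y (bracket x z)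

namespace LieSuperalgebra

variable {𝕜 V : Type*} [Field 𝕜] [AddCommGroup V] [Module 𝕜 V]

/-- The relations `x y = (-1)^{|x||y|} y x + [x, y]` (for homogeneous `x`, `y`) in the tensor
algebra of the Lie superalgebra. -/
inductive EnvRel (A : LieSuperalgebra 𝕜 V) : TensorAlgebra 𝕜 V → TensorAlgebra 𝕜 V → Prop
  | comm (i j : ZMod 2) (x y : V) (hx : x ∈ A.gr i) (hy : y ∈ A.gr j) :
      EnvRel A (TensorAlgebra.ι 𝕜 x * TensorAlgebra.ι 𝕜 y)
        ((-1 : 𝕜) ^ (i.val * j.val) • (TensorAlgebra.ι 𝕜 y * TensorAlgebra.ι 𝕜 x) +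
          TensorAlgebra.ι 𝕜 (A.bracket x y))

/-- The universal enveloping algebra of a Lie superalgebra: the quotient of the tensor algebra by
the two-sided ideal generated by all `x y - (-1)^{|x||y|} y x - [x, y]`. -/
def Enveloping (A : LieSuperalgebra 𝕜 V) : Type _ := RingQuot A.EnvRel

instance (A : LieSuperalgebra 𝕜 V) : Ring A.Enveloping :=
  inferInstanceAs (Ring (RingQuot A.EnvRel))

instance (A : LieSuperalgebra 𝕜 V) : Algebra 𝕜 A.Enveloping :=
  inferInstanceAs (Algebra 𝕜 (RingQuot A.EnvRel))

/-- The canonical linear map from a Lie superalgebra to its universal enveloping algebra. -/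
def ι (A : LieSuperalgebra 𝕜 V) : V →ₗ[𝕜] A.Enveloping :=
  (RingQuot.mkAlgHom 𝕜 A.EnvRel).toLinearMap ∘ₗ TensorAlgebra.ι 𝕜

/-- `IsMonomial A p u`: `u` is a (possibly empty) product of images of homogeneous elements of the
Lie superalgebra whose parities add up to `p`. -/
inductive IsMonomial (A : LieSuperalgebra 𝕜 V) : ZMod 2 → A.Enveloping → Prop
  | one : IsMonomial A 0 1
  | mul (i j : ZMod 2) (x : V) (u : A.Enveloping) (hx : x ∈ A.gr i) (hu : IsMonomial A j u) :
      IsMonomial A (i + j) (A.ι x * u)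

/-- The even part (`p = 0`) and the odd part (`p = 1`) of the universal enveloping algebra. -/
def envGr (A : LieSuperalgebra 𝕜 V) (p : ZMod 2) : Submodule 𝕜 A.Enveloping :=
  Submodule.span 𝕜 {u | A.IsMonomial p u}

/-- The supercenter of the universal enveloping algebra: the span of the homogeneous elements `z`
with `z u = (-1)^{|z||u|} u z` for all homogeneous `u`. -/
def supercenter (A : LieSuperalgebra 𝕜 V) : Submodule 𝕜 A.Enveloping :=
  Submodule.span 𝕜 {z | ∃ i : ZMod 2, z ∈ A.envGr i ∧
    ∀ (j : ZMod 2), ∀ u ∈ A.envGr j, z * u = (-1 : 𝕜) ^ (i.val * j.val) • (u * z)}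

end LieSuperalgebra

/-- Labels of the basis of `𝔮_ε`. The label `G k` stands for the basis vector `G_{k + ε}`, so that
`k` runs through `ℤ` when the index `r = k + ε` runs through `ℤ + ε`. -/
inductive QIndex : Type
  | L (m : ℤ)
  | H (m : ℤ)
  | G (k : ℤ)
  | C

namespace QIndex

/-- `L_m`, `H_m`, `C` are even, `G_r` is odd. -/
def parity : QIndex → ZMod 2
  | L _ => 0
  | H _ => 0
  | G _ => 1
  | C => 0

/-- The brackets of the basis vectors of `𝔮_ε`:
`[L_m, L_n] = (n - m) L_{m+n} + δ_{m+n,0} (n³ - n)/12 C`, `[H_m, H_n] = δ_{m+n,0} m/3 C`,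
`[L_m, H_n] = n H_{m+n}`, `[L_m, G_r] = (r - m/2) G_{m+r}`, `[H_m, G_r] = G_{m+r}`,
`[G_r, G_s] = 0`, and `C` is central. -/
noncomputable def bracket (ε : ℂ) : QIndex → QIndex → (QIndex →₀ ℂ)
  | L m, L n => Finsupp.single (L (m + n)) ((n : ℂ) - m) +
      Finsupp.single C (if m + n = 0 then ((n : ℂ) ^ 3 - n) / 12 else 0)
  | L m, H n => Finsupp.single (H (m + n)) (n : ℂ)
  | L m, G k => Finsupp.single (G (m + k)) (((k : ℂ) + ε) - (m : ℂ) / 2)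
  | H n, L m => -Finsupp.single (H (m + n)) (n : ℂ)
  | H m, H n => Finsupp.single C (if m + n = 0 then (m : ℂ) / 3 else 0)
  | H m, G k => Finsupp.single (G (m + k)) 1
  | G k, L m => -Finsupp.single (G (m + k)) (((k : ℂ) + ε) - (m : ℂ) / 2)
  | G k, H m => -Finsupp.single (G (m + k)) 1
  | G _, G _ => 0
  | C, _ => 0
  | _, C => 0

/-- The bilinear extension of the brackets of the basis vectors. -/
noncomputable def bracketₗ (ε : ℂ) : (QIndex →₀ ℂ) →ₗ[ℂ] (QIndex →₀ ℂ) →ₗ[ℂ] (QIndex →₀ ℂ) :=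
  Finsupp.linearCombination ℂ fun a => Finsupp.linearCombination ℂ fun b => bracket ε a b

theorem bracketₗ_single (ε : ℂ) (a b : QIndex) (s t : ℂ) :
    bracketₗ ε (Finsupp.single a s) (Finsupp.single b t) = (s * t) • bracket ε a b := by
  simp [bracketₗ, mul_smul]

/-- The even part (`i = 0`) and the odd part (`i = 1`) of `𝔮_ε`. -/
noncomputable def gr (i : ZMod 2) : Submodule ℂ (QIndex →₀ ℂ) :=
  Finsupp.supported ℂ ℂ {b | parity b = i}

theorem gr_eq_span (i : ZMod 2) :
    gr i = Submodule.span ℂ ((fun b => Finsupp.single b (1 : ℂ)) '' {b | parity b = i}) :=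
  Finsupp.supported_eq_span_single ℂ _

theorem single_mem_gr {i : ZMod 2} {b : QIndex} (h : parity b = i) (s : ℂ) :
    Finsupp.single b s ∈ gr i :=
  Finsupp.single_mem_supported ℂ s h

theorem isInternal_gr : DirectSum.IsInternal gr := by
  refine (DirectSum.isInternal_submodule_iff_isCompl gr (i := 0) (j := 1) (by decide) ?_).2 ?_
  · ext i
    fin_cases i
    · exact ⟨fun _ => Or.inl rfl, fun _ => trivial⟩
    · exact ⟨fun _ => Or.inr rfl, fun _ => trivial⟩
  · refine ⟨Finsupp.disjoint_supported_supported ?_, Finsupp.codisjoint_supported_supported ?_⟩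
    · rw [Set.disjoint_left]
      intro b h0 h1
      change parity b = 0 at h0
      change parity b = 1 at h1
      rw [h0] at h1
      exact absurd h1 (by decide)
    · rw [codisjoint_iff]
      ext b
      cases b <;> simp [parity]

theorem bracket_mem (ε : ℂ) (a b : QIndex) : bracket ε a b ∈ gr (parity a + parity b) := by
  cases a <;> cases b <;> simp only [bracket] <;>
    first
    | exact Submodule.zero_mem _
    | exact single_mem_gr (by simp [parity]) _
    | exact Submodule.neg_mem _ (single_mem_gr (by simp [parity]) _)
    | exact Submodule.add_mem _ (single_mem_gr (by simp [parity]) _)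
        (single_mem_gr (by simp [parity]) _)

theorem bracket_skew (ε : ℂ) (a b : QIndex) :
    bracket ε a b = -((-1 : ℂ) ^ ((parity a).val * (parity b).val) • bracket ε b a) := by
  cases a <;> cases b <;> simp [bracket, parity, add_comm]
  case L.L m n =>
    by_cases h : m + n = 0
    · obtain rfl : n = -m := by omega
      have h2 : ((-(m : ℂ)) ^ 3 + m) / 12 = -(((m : ℂ) ^ 3 - m) / 12) := by ring
      simp only [Int.cast_neg, sub_neg_eq_add, h2, add_neg_cancel, if_true]
      rw [← sub_eq_zero]
      ext d
      cases d <;> simp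
    · simp only [h, if_false, Finsupp.single_zero]
      simp
  case H.H m n =>
    by_cases h : m + n = 0
    · obtain rfl : n = -m := by omega
      simp [neg_div]
    · simp [h]

theorem bracket_jacobi (ε : ℂ) (a b c : QIndex) :
    bracketₗ ε (Finsupp.single a 1) (bracket ε b c) =
      bracketₗ ε (bracket ε a b) (Finsupp.single c 1) +
        (-1 : ℂ) ^ ((parity a).val * (parity b).val) •
          bracketₗ ε (Finsupp.single b 1) (bracket ε a c) := by
  have h0 : ((0 : ZMod 2).val) = 0 := rfl
  have h1 : ((1 : ZMod 2).val) = 1 := rfl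
  cases a <;> cases b <;> cases c <;>
    simp only [bracket, parity, map_add, map_neg, map_zero, LinearMap.add_apply,
      LinearMap.neg_apply, LinearMap.zero_apply, bracketₗ_single, smul_add, smul_neg, smul_zero,
      Finsupp.smul_single, smul_eq_mul, h0, h1, mul_zero, pow_zero, one_smul, one_mul,
      mul_one, add_zero, zero_add, neg_zero, add_comm, add_left_comm, neg_neg]
  all_goals try simp only [← Finsupp.single_neg, ← Finsupp.single_add]
  case L.L.L x y z =>
    by_cases h : x + (y + z) = 0
    · obtain rfl : z = -(x + y) := by omega
      simp only [h, if_true]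
      rw [← add_assoc, ← Finsupp.single_add]
      congr 2 <;> push_cast <;> ring
    · simp only [h, if_false, mul_zero, Finsupp.single_zero, zero_add]
      congr 1
      push_cast
      ring
  case L.H.H x y z =>
    by_cases h : x + (y + z) = 0
    · obtain rfl : z = -(x + y) := by omega
      rw [eq_comm, Finsupp.single_eq_zero]
      simp only [h, if_true]
      push_cast
      ring
    · simp [h]
  case H.L.H x y z =>
    by_cases h : x + (y + z) = 0
    · obtain rfl : z = -(x + y) := by omega
      simp only [h, if_true]
      congr 1
      push_cast
      ring
    · simp [h]
  case H.H.L x y z =>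
    congr 1
    split_ifs <;> ring
  case G.H.H => simp
  all_goals
    congr 1
    push_cast
    ring

end QIndex

/-- The Lie superalgebra `𝔮_ε`, on the complex vector space with basis
`L_m`, `H_m` (`m ∈ ℤ`), `G_r` (`r ∈ ℤ + ε`) and `C`. -/
noncomputable def qAlgebra (ε : ℂ) : LieSuperalgebra ℂ (QIndex →₀ ℂ) where
  gr := QIndex.gr
  isInternal_gr := QIndex.isInternal_gr
  bracket := QIndex.bracketₗ ε
  bracket_mem := by
    intro i j x y hx hy
    rw [QIndex.gr_eq_span] at hx hy
    induction hx using Submodule.span_induction with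
    | zero => simp
    | add x x' _ _ h h' => simpa using Submodule.add_mem _ h h'
    | smul t x _ h => simpa using Submodule.smul_mem _ t h
    | mem x hx =>
      obtain ⟨a, rfl, rfl⟩ := hx
      induction hy using Submodule.span_induction with
      | zero => simp
      | add x x' _ _ h h' => simpa using Submodule.add_mem _ h h'
      | smul t x _ h => simpa using Submodule.smul_mem _ t h
      | mem y hy =>
        obtain ⟨b, rfl, rfl⟩ := hy
        simpa [QIndex.bracketₗ_single] using QIndex.bracket_mem ε a b
  bracket_skew := by
    intro i j x y hx hy
    rw [QIndex.gr_eq_span] at hx hy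
    induction hx using Submodule.span_induction with
    | zero => simp
    | add x x' _ _ h h' => simp only [map_add, LinearMap.add_apply, h, h', smul_add, neg_add]
    | smul t x _ h =>
      simp only [map_smul, LinearMap.smul_apply, h, smul_neg]
      rw [smul_comm]
    | mem x hx =>
      obtain ⟨a, rfl, rfl⟩ := hx
      induction hy using Submodule.span_induction with
      | zero => simp
      | add x x' _ _ h h' => simp only [map_add, LinearMap.add_apply, h, h', smul_add, neg_add]
      | smul t x _ h =>
        simp only [map_smul, LinearMap.smul_apply, h, smul_neg]
        rw [smul_comm]
      | mem y hy =>
        obtain ⟨b, rfl, rfl⟩ := hy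
        simpa [QIndex.bracketₗ_single] using QIndex.bracket_skew ε a b
  bracket_jacobi := by
    intro i j k x y z hx hy hz
    rw [QIndex.gr_eq_span] at hx hy hz
    induction hx using Submodule.span_induction with
    | zero => simp
    | add x x' _ _ h h' =>
      simp only [map_add, LinearMap.add_apply, h, h', smul_add]
      abel
    | smul t x _ h =>
      simp only [map_smul, LinearMap.smul_apply, h, smul_add]
      rw [smul_comm]
    | mem x hx =>
      obtain ⟨a, rfl, rfl⟩ := hx
      induction hy using Submodule.span_induction with
      | zero => simp
      | add x x' _ _ h h' =>
        simp only [map_add, LinearMap.add_apply, h, h', smul_add]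
        abel
      | smul t x _ h =>
        simp only [map_smul, LinearMap.smul_apply, h, smul_add]
        rw [smul_comm]
      | mem y hy =>
        obtain ⟨b, rfl, rfl⟩ := hy
        induction hz using Submodule.span_induction with
        | zero => simp
        | add x x' _ _ h h' =>
          simp only [map_add, h, h', smul_add]
          abel
        | smul t x _ h =>
          simp only [map_smul, h, smul_add]
          rw [smul_comm]
        | mem z hz =>
          obtain ⟨c, rfl, rfl⟩ := hz
          simpa [QIndex.bracketₗ_single] using QIndex.bracket_jacobi ε a b c

/-- The image of the central element `C` in the universal enveloping algebra of `𝔮_ε`. -/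
noncomputable def envC (ε : ℂ) : (qAlgebra ε).Enveloping :=
  (qAlgebra ε).ι (Finsupp.single QIndex.C 1)

/-! ### Universal property and generation of the enveloping algebra. -/

namespace LieSuperalgebra

variable {𝕜 V : Type*} [Field 𝕜] [AddCommGroup V] [Module 𝕜 V]

/-! A central element `z` is located in two steps, without a PBW theorem. First, `ad H_0` multiplies
a word by its number of `G`'s, so an element commuting with `H_0` is a combination of words in
`L_m`, `H_m`, `C` alone (`mem_span_of_commute_H_zero`).

Second, such an element is tested on a polynomial ring. The even generators act by operators of
order at most one, with `C` acting as multiplication by the variable `c`. The `G_r` act by zero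
(`exists_evenRep`) or, over the dual numbers, by the nilpotent unit times multiplication by a
variable (`exists_dualRep`). Commuting with the `G_r` then forces the operator of `z` to commute
with multiplication by `y = x_{0,0} + x_{1,0}` (`commMul_eq_zero_of_commute_G`).

On an operator from words of weight at most `d`, `d` successive commutators with `y` give `d!` times
its symbol of order `d` at `dy` (`commMul_pow_weight`). The symbols of the `L_m`, `H_m` and `C` are
algebraically independent (`straighten_symbol`), so for `d > 0` the part of `z` of weight `d`
vanishes (`mem_evenFiltration_of_commMul`). Descending, `z` has weight zero and is a polynomial in
`C`. The same representation shows that `C` is transcendental. For the supercenter, an odd element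
commuting with `H_0` is zero (`eq_zero_of_mem_envGr_one`). -/

theorem ι_mul_ι (A : LieSuperalgebra 𝕜 V) {i j : ZMod 2} {x y : V} (hx : x ∈ A.gr i)
    (hy : y ∈ A.gr j) :
    A.ι x * A.ι y = (-1 : 𝕜) ^ (i.val * j.val) • (A.ι y * A.ι x) + A.ι (A.bracket x y) := by
  have h := RingQuot.mkAlgHom_rel 𝕜 (EnvRel.comm (A := A) i j x y hx hy)
  simp only [map_mul, map_add, map_smul] at h
  exact h

/-- The universal property of the enveloping algebra. -/
def lift (A : LieSuperalgebra 𝕜 V) {R : Type*} [Ring R] [Algebra 𝕜 R] (f : V →ₗ[𝕜] R)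
    (hf : ∀ (i j : ZMod 2) (x y : V), x ∈ A.gr i → y ∈ A.gr j →
      f x * f y = (-1 : 𝕜) ^ (i.val * j.val) • (f y * f x) + f (A.bracket x y)) :
    A.Enveloping →ₐ[𝕜] R :=
  RingQuot.liftAlgHom 𝕜 ⟨TensorAlgebra.lift 𝕜 f, by
    rintro _ _ ⟨i, j, x, y, hx, hy⟩
    simpa using hf i j x y hx hy⟩

theorem lift_ι (A : LieSuperalgebra 𝕜 V) {R : Type*} [Ring R] [Algebra 𝕜 R] (f : V →ₗ[𝕜] R)
    (hf : ∀ (i j : ZMod 2) (x y : V), x ∈ A.gr i → y ∈ A.gr j →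
      f x * f y = (-1 : 𝕜) ^ (i.val * j.val) • (f y * f x) + f (A.bracket x y)) (x : V) :
    A.lift f hf (A.ι x) = f x := by
  change RingQuot.liftAlgHom 𝕜 _ (RingQuot.mkAlgHom 𝕜 A.EnvRel (TensorAlgebra.ι 𝕜 x)) = f x
  rw [RingQuot.liftAlgHom_mkAlgHom_apply, TensorAlgebra.lift_ι_apply]

theorem adjoin_range_ι (A : LieSuperalgebra 𝕜 V) :
    Algebra.adjoin 𝕜 (Set.range A.ι) = ⊤ := by
  have h : Set.range A.ι = RingQuot.mkAlgHom 𝕜 A.EnvRel '' Set.range (TensorAlgebra.ι 𝕜) := by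
    rw [← Set.range_comp]; rfl
  have h2 := AlgHom.map_adjoin (RingQuot.mkAlgHom 𝕜 A.EnvRel) (Set.range (TensorAlgebra.ι 𝕜))
  rw [TensorAlgebra.adjoin_range_ι, Algebra.map_top,
    (AlgHom.range_eq_top _).2 (RingQuot.mkAlgHom_surjective 𝕜 A.EnvRel)] at h2
  rw [h]
  exact h2.symm

theorem ι_mem_envGr (A : LieSuperalgebra 𝕜 V) {i : ZMod 2} {x : V} (hx : x ∈ A.gr i) :
    A.ι x ∈ A.envGr i := by
  have h := IsMonomial.mul (A := A) i 0 x 1 hx IsMonomial.one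
  rw [add_zero, mul_one] at h
  exact Submodule.subset_span h

end LieSuperalgebra

/-! ### Generators of the enveloping algebra and the words they span. -/

namespace QIndex

/-- The basis vectors of `𝔮_ε` as elements of the enveloping algebra. -/
noncomputable def gen (ε : ℂ) (a : QIndex) : (qAlgebra ε).Enveloping :=
  (qAlgebra ε).ι (Finsupp.single a 1)

variable {ε : ℂ}

theorem gen_C : gen ε C = envC ε := rfl

theorem ι_single (a : QIndex) (t : ℂ) :
    (qAlgebra ε).ι (Finsupp.single a t) = t • gen ε a := by
  rw [gen, ← map_smul, Finsupp.smul_single, smul_eq_mul, mul_one]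

theorem gen_mul_gen (a b : QIndex) :
    gen ε a * gen ε b = (-1 : ℂ) ^ ((parity a).val * (parity b).val) • (gen ε b * gen ε a) +
      (qAlgebra ε).ι (bracket ε a b) := by
  have h := (qAlgebra ε).ι_mul_ι (single_mem_gr (b := a) rfl 1) (single_mem_gr (b := b) rfl 1)
  rw [show (qAlgebra ε).bracket (Finsupp.single a 1) (Finsupp.single b 1) = bracket ε a b from by
    simp [qAlgebra, bracketₗ_single]] at h
  exact h

theorem gen_mem_envGr (a : QIndex) : gen ε a ∈ (qAlgebra ε).envGr (parity a) :=
  (qAlgebra ε).ι_mem_envGr (single_mem_gr rfl 1)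

/-- An algebra map out of `U(𝔮_ε)` is given by the images of the basis vectors. -/
theorem exists_algHom {R : Type*} [Ring R] [Algebra ℂ R] (f : QIndex → R)
    (hf : ∀ a b, f a * f b = (-1 : ℂ) ^ ((parity a).val * (parity b).val) • (f b * f a) +
      Finsupp.linearCombination ℂ f (bracket ε a b)) :
    ∃ F : (qAlgebra ε).Enveloping →ₐ[ℂ] R, ∀ a, F (gen ε a) = f a := by
  refine ⟨(qAlgebra ε).lift (Finsupp.linearCombination ℂ f) ?_, fun a => ?_⟩
  · intro i j x y hx hy
    change x ∈ gr i at hx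
    change y ∈ gr j at hy
    change _ = _ + Finsupp.linearCombination ℂ f (bracketₗ ε x y)
    rw [gr_eq_span] at hx hy
    induction hx using Submodule.span_induction with
    | zero => simp
    | add x x' _ _ h h' =>
      simp only [map_add, LinearMap.add_apply, add_mul, mul_add, h, h', smul_add]
      abel
    | smul t x _ h =>
      simp only [map_smul, LinearMap.smul_apply, smul_mul_assoc, mul_smul_comm, h, smul_add]
      rw [smul_comm]
    | mem x hx =>
      obtain ⟨a, rfl, rfl⟩ := hx
      induction hy using Submodule.span_induction with
      | zero => simp
      | add x x' _ _ h h' =>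
        simp only [map_add, add_mul, mul_add, h, h', smul_add]
        abel
      | smul t x _ h =>
        simp only [map_smul, smul_mul_assoc, mul_smul_comm, h, smul_add]
        rw [smul_comm]
      | mem y hy =>
        obtain ⟨b, rfl, rfl⟩ := hy
        simpa [bracketₗ_single] using hf a b
  · rw [gen, LieSuperalgebra.lift_ι, Finsupp.linearCombination_single, one_smul]

theorem adjoin_range_gen : Algebra.adjoin ℂ (Set.range (gen ε)) = ⊤ := by
  rw [eq_top_iff, ← LieSuperalgebra.adjoin_range_ι]
  refine Algebra.adjoin_le ?_
  rintro _ ⟨x, rfl⟩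
  induction x using Finsupp.induction_linear with
  | zero => simp
  | add x y hx hy =>
    rw [map_add]
    exact add_mem hx hy
  | single a t =>
    rw [ι_single]
    exact Subalgebra.smul_mem _ (Algebra.subset_adjoin (Set.mem_range_self a)) t

/-- The product of the generators along a list of labels. -/
noncomputable def word (ε : ℂ) (l : List QIndex) : (qAlgebra ε).Enveloping :=
  (l.map (gen ε)).prod

theorem word_nil : word ε [] = 1 := rfl

theorem word_cons (a : QIndex) (l : List QIndex) : word ε (a :: l) = gen ε a * word ε l := by
  simp [word]

theorem span_range_word : Submodule.span ℂ (Set.range (word ε)) = ⊤ := by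
  have h := Algebra.adjoin_eq_span (R := ℂ) (Set.range (gen ε))
  rw [adjoin_range_gen] at h
  rw [eq_top_iff, ← Algebra.top_toSubmodule, h]
  refine Submodule.span_mono ?_
  intro u hu
  induction hu using Submonoid.closure_induction_left with
  | one => exact ⟨[], rfl⟩
  | mul_left x hx y _ ih =>
    obtain ⟨a, rfl⟩ := hx
    obtain ⟨l, rfl⟩ := ih
    exact ⟨a :: l, word_cons a l⟩

theorem mem_center_of_commute_gen {z : (qAlgebra ε).Enveloping}
    (h : ∀ a, z * gen ε a = gen ε a * z) : z ∈ Subalgebra.center ℂ (qAlgebra ε).Enveloping := by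
  have h2 : (⊤ : Subalgebra ℂ (qAlgebra ε).Enveloping) ≤ Subalgebra.centralizer ℂ {z} := by
    rw [← adjoin_range_gen]
    refine Algebra.adjoin_le ?_
    rintro _ ⟨a, rfl⟩
    rw [SetLike.mem_coe, Subalgebra.mem_centralizer_iff]
    rintro _ rfl
    exact h a
  rw [Subalgebra.mem_center_iff]
  intro b
  have := h2 (Algebra.mem_top (x := b))
  rw [Subalgebra.mem_centralizer_iff] at this
  exact (this z rfl).symm

theorem envC_mem_center : envC ε ∈ Subalgebra.center ℂ (qAlgebra ε).Enveloping := by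
  refine mem_center_of_commute_gen fun a => ?_
  have h := gen_mul_gen (ε := ε) C a
  simpa [parity, bracket, gen_C] using h

/-! ### The grading by `ad H_0`. -/

/-- The number of odd generators in a word. -/
def oddCount : List QIndex → ℕ
  | [] => 0
  | G _ :: l => oddCount l + 1
  | _ :: l => oddCount l

/-- `ad H_0` is a derivation that kills every even generator and fixes every `G_r`. -/
theorem gen_H_zero_mul_word (l : List QIndex) :
    gen ε (H 0) * word ε l - word ε l * gen ε (H 0) = (oddCount l : ℂ) • word ε l := by
  induction l with
  | nil => simp [word_nil, oddCount]
  | cons a l ih =>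
    have key : ∀ t : ℂ, gen ε (H 0) * gen ε a = gen ε a * gen ε (H 0) + t • gen ε a →
        gen ε (H 0) * word ε (a :: l) - word ε (a :: l) * gen ε (H 0) =
          (oddCount l + t) • word ε (a :: l) := by
      intro t ht
      rw [word_cons, ← mul_assoc, ht, add_smul, ← mul_smul_comm, ← ih]
      simp only [add_mul, smul_mul_assoc]
      noncomm_ring
    have hg := gen_mul_gen (ε := ε) (H 0) a
    cases a with
    | L m => simpa [oddCount] using key 0 (by simpa [parity, bracket] using hg)
    | H m => simpa [oddCount] using key 0 (by simpa [parity, bracket] using hg)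
    | C => simpa [oddCount] using key 0 (by simpa [parity, bracket] using hg)
    | G k => simpa [oddCount] using key 1 (by simpa [parity, bracket, ι_single] using hg)

/-- `ad H_0`. -/
noncomputable def adHzero (ε : ℂ) : Module.End ℂ (qAlgebra ε).Enveloping :=
  LinearMap.mulLeft ℂ (gen ε (H 0)) - LinearMap.mulRight ℂ (gen ε (H 0))

theorem word_mem_eigenspace (l : List QIndex) :
    word ε l ∈ (adHzero ε).eigenspace (oddCount l : ℂ) := by
  rw [Module.End.mem_eigenspace_iff]
  exact gen_H_zero_mul_word l

/-- Eigenspaces for distinct eigenvalues are independent, so no linear independence of words is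
needed. -/
theorem disjoint_eigenspace :
    Disjoint ((adHzero ε).eigenspace 0)
      (Submodule.span ℂ (word ε '' {l | oddCount l ≠ 0})) := by
  refine ((adHzero ε).eigenspaces_iSupIndep 0).mono_right ?_
  rw [Submodule.span_le]
  rintro _ ⟨l, hl, rfl⟩
  refine Submodule.mem_iSup_of_mem (oddCount l : ℂ) ?_
  exact Submodule.mem_iSup_of_mem (by simpa using hl) (word_mem_eigenspace l)

/-- An element that commutes with `H_0` is a combination of words in the even generators. -/
theorem mem_span_of_commute_H_zero {z : (qAlgebra ε).Enveloping}
    (hz : z * gen ε (H 0) = gen ε (H 0) * z) :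
    z ∈ Submodule.span ℂ (word ε '' {l | oddCount l = 0}) := by
  have h : z ∈ Submodule.span ℂ (word ε '' {l | oddCount l = 0}) ⊔
      Submodule.span ℂ (word ε '' {l | oddCount l ≠ 0}) := by
    rw [← Submodule.span_union, ← Set.image_union,
      show {l | oddCount l = 0} ∪ {l | oddCount l ≠ 0} = Set.univ from Set.union_compl_self _,
      Set.image_univ, span_range_word]
    trivial
  obtain ⟨z₀, h₀, z₁, h₁, rfl⟩ := Submodule.mem_sup.1 h
  have h₀' : z₀ ∈ (adHzero ε).eigenspace 0 := by
    refine Submodule.span_le.2 ?_ h₀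
    rintro _ ⟨l, hl, rfl⟩
    have := word_mem_eigenspace (ε := ε) l
    rwa [show oddCount l = 0 from hl, Nat.cast_zero] at this
  have hz' : z₀ + z₁ ∈ (adHzero ε).eigenspace 0 := by
    rw [Module.End.mem_eigenspace_iff, zero_smul]
    exact sub_eq_zero.2 hz.symm
  have : z₁ = 0 := by
    refine (Submodule.disjoint_def.1 disjoint_eigenspace) z₁ ?_ h₁
    simpa using Submodule.sub_mem _ hz' h₀'
  rwa [this, add_zero]

/-- An odd element is a combination of words with an odd number of `G`'s, on which the eigenvalues
of `ad H_0` are nonzero. -/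
theorem eq_zero_of_mem_envGr_one {z : (qAlgebra ε).Enveloping}
    (hz : z * gen ε (H 0) = gen ε (H 0) * z) (hz1 : z ∈ (qAlgebra ε).envGr 1) : z = 0 := by
  have key : ∀ p u, (qAlgebra ε).IsMonomial p u →
      u ∈ Submodule.span ℂ (word ε '' {l | (oddCount l : ZMod 2) = p}) := by
    intro p u hu
    induction hu with
    | one => exact Submodule.subset_span ⟨[], by simp [oddCount], rfl⟩
    | mul i j x u hx hu ih =>
      clear hu
      change x ∈ gr i at hx
      rw [gr_eq_span] at hx
      induction hx using Submodule.span_induction with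
      | zero => simp
      | add x x' _ _ h h' =>
        rw [map_add, add_mul]
        exact add_mem h h'
      | smul t x _ h =>
        rw [map_smul, smul_mul_assoc]
        exact Submodule.smul_mem _ t h
      | mem x hx =>
        obtain ⟨a, ha, rfl⟩ := hx
        change gen ε a * u ∈ _
        induction ih using Submodule.span_induction with
        | zero => simp
        | add x x' _ _ h h' =>
          rw [mul_add]
          exact add_mem h h'
        | smul t x _ h =>
          rw [mul_smul_comm]
          exact Submodule.smul_mem _ t h
        | mem x hx =>
          obtain ⟨l, hl, rfl⟩ := hx
          refine Submodule.subset_span ⟨a :: l, ?_, word_cons a l⟩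
          change parity a = i at ha
          change (oddCount l : ZMod 2) = j at hl
          change (oddCount (a :: l) : ZMod 2) = i + j
          rw [← ha, ← hl]
          cases a <;> simp [oddCount, parity, add_comm]
  refine (Submodule.disjoint_def.1 disjoint_eigenspace) z ?_ ?_
  · rw [Module.End.mem_eigenspace_iff, zero_smul]
    exact sub_eq_zero.2 hz.symm
  · have h2 : (qAlgebra ε).envGr 1 ≤
        Submodule.span ℂ (word ε '' {l | (oddCount l : ZMod 2) = 1}) :=
      Submodule.span_le.2 fun u hu => key 1 u hu
    refine Submodule.span_mono (Set.image_mono ?_) (h2 hz1)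
    intro l hl h0
    change (oddCount l : ZMod 2) = 1 at hl
    rw [show oddCount l = 0 from h0, Nat.cast_zero] at hl
    exact absurd hl (by decide)

end QIndex

/-! ### The filtration of even words by the number of factors `L_m`, `H_m`. -/

namespace QIndex

variable {ε : ℂ}

theorem parity_G_ne_zero (k : ℤ) : parity (G k) ≠ 0 := one_ne_zero (α := ZMod 2)

/-- The number of factors `L_m`, `H_m` in a word. -/
def weight : List QIndex → ℕ
  | [] => 0
  | L _ :: l => weight l + 1
  | H _ :: l => weight l + 1
  | _ :: l => weight l

/-- The span of the words in the even generators with fewer than `d` factors `L_m`, `H_m`. -/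
noncomputable def evenFiltration (ε : ℂ) (d : ℕ) : Submodule ℂ (qAlgebra ε).Enveloping :=
  Submodule.span ℂ (word ε '' {l | oddCount l = 0 ∧ weight l < d})

theorem word_mem_evenFiltration {l : List QIndex} {d : ℕ} (h0 : oddCount l = 0)
    (hd : weight l < d) : word ε l ∈ evenFiltration ε d :=
  Submodule.subset_span ⟨l, ⟨h0, hd⟩, rfl⟩

theorem evenFiltration_mono {d e : ℕ} (h : d ≤ e) : evenFiltration ε d ≤ evenFiltration ε e :=
  Submodule.span_mono (Set.image_mono fun _ hl => ⟨hl.1, hl.2.trans_le h⟩)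

theorem gen_mul_mem_evenFiltration {a : QIndex} (ha : parity a = 0) {d : ℕ}
    {u : (qAlgebra ε).Enveloping} (hu : u ∈ evenFiltration ε d) :
    gen ε a * u ∈ evenFiltration ε (d + weight [a]) := by
  induction hu using Submodule.span_induction with
  | zero => simp
  | add x y _ _ hx hy =>
    rw [mul_add]
    exact add_mem hx hy
  | smul t x _ hx =>
    rw [mul_smul_comm]
    exact Submodule.smul_mem _ t hx
  | mem x hx =>
    obtain ⟨l, ⟨h0, hl⟩, rfl⟩ := hx
    rw [← word_cons]
    cases a <;> first
      | exact word_mem_evenFiltration h0 (by simp [weight, hl])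
      | exact absurd ha (parity_G_ne_zero _)

theorem weight_eq_of_perm {l l' : List QIndex} (h : l.Perm l') : weight l = weight l' := by
  induction h with
  | nil => rfl
  | cons a _ ih => cases a <;> simp [weight, ih]
  | swap a b l => cases a <;> cases b <;> simp [weight]
  | trans _ _ h h' => exact h.trans h'

theorem oddCount_eq_of_perm {l l' : List QIndex} (h : l.Perm l') :
    oddCount l = oddCount l' := by
  induction h with
  | nil => rfl
  | cons a _ ih => cases a <;> simp [oddCount, ih]
  | swap a b l => cases a <;> cases b <;> simp [oddCount]
  | trans _ _ h h' => exact h.trans h'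

/-- Reordering a word in the even generators changes it by terms of lower weight. -/
theorem word_sub_word_mem_of_perm {l l' : List QIndex} (h : l.Perm l') (h0 : oddCount l = 0) :
    word ε l - word ε l' ∈ evenFiltration ε (weight l) := by
  induction h with
  | nil => simp
  | @cons a l l' _ ih =>
    rw [word_cons, word_cons, ← mul_sub]
    have ha : parity a = 0 ∧ oddCount l = 0 ∧ weight (a :: l) = weight l + weight [a] := by
      cases a <;> simp_all [parity, oddCount, weight]
    rw [ha.2.2]
    exact gen_mul_mem_evenFiltration ha.1 (ih ha.2.1)
  | swap a b l =>
    have h : word ε (b :: a :: l) - word ε (a :: b :: l) =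
        (gen ε b * gen ε a - gen ε a * gen ε b) * word ε l := by
      simp only [word_cons]
      noncomm_ring
    have hp : parity a = 0 ∧ parity b = 0 ∧ oddCount l = 0 := by
      cases a <;> cases b <;> simp_all [parity, oddCount]
    have hg := gen_mul_gen (ε := ε) b a
    rw [hp.1, hp.2.1, ZMod.val_zero, mul_zero, pow_zero, one_smul, ← sub_eq_iff_eq_add'] at hg
    rw [h, hg]
    replace h0 := hp.2.2
    -- The bracket of two factors of weight one has weight at most one, a loss of at least one;
    -- brackets with `C` vanish.
    cases a <;> cases b <;>
      simp only [bracket, map_add, map_neg, ι_single, map_zero, add_mul, smul_mul_assoc, zero_mul,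
        neg_mul, ← word_cons] <;>
      first
      | exact absurd hp.1 (parity_G_ne_zero _)
      | exact absurd hp.2.1 (parity_G_ne_zero _)
      | exact Submodule.zero_mem _
      | exact Submodule.add_mem _
          (Submodule.smul_mem _ _ (word_mem_evenFiltration h0 (by simp [weight])))
          (Submodule.smul_mem _ _ (word_mem_evenFiltration h0 (by simp [weight])))
      | exact Submodule.neg_mem _ (Submodule.smul_mem _ _
          (word_mem_evenFiltration h0 (by simp [weight])))
      | exact Submodule.smul_mem _ _ (word_mem_evenFiltration h0 (by simp [weight]))
  | trans h₁ _ ih ih' =>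
    have h2 := add_mem (ih h0) (weight_eq_of_perm h₁ ▸ ih' (oddCount_eq_of_perm h₁ ▸ h0))
    simpa using h2

/-- The word of a multiset of labels, in an arbitrary fixed order. -/
noncomputable def multisetWord (ε : ℂ) (s : Multiset QIndex) : (qAlgebra ε).Enveloping :=
  word ε s.toList

/-- Modulo lower weight the order of the factors is irrelevant, so one word per multiset suffices.
The bound in `evenFiltration` is strict, so level `d + 1` has top weight `d`. -/
theorem evenFiltration_succ_le (d : ℕ) :
    evenFiltration ε (d + 1) ≤
      Submodule.span ℂ (multisetWord ε '' {s | oddCount s.toList = 0 ∧ weight s.toList = d}) ⊔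
        evenFiltration ε d := by
  refine Submodule.span_le.2 ?_
  rintro _ ⟨l, ⟨h0, hl⟩, rfl⟩
  rcases (Nat.lt_succ_iff.1 hl).lt_or_eq with h | h
  · exact Submodule.mem_sup_right (word_mem_evenFiltration h0 h)
  · have hp : l.Perm (l : Multiset QIndex).toList :=
      Multiset.coe_eq_coe.1 (Multiset.coe_toList _).symm
    rw [← sub_add_cancel (word ε l) (multisetWord ε l), add_comm]
    refine Submodule.add_mem_sup (Submodule.subset_span ⟨_, ⟨?_, ?_⟩, rfl⟩) ?_
    · rw [← oddCount_eq_of_perm hp, h0]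
    · rw [← weight_eq_of_perm hp, h]
    · exact h ▸ word_sub_word_mem_of_perm hp h0

theorem evenFiltration_one_le :
    evenFiltration ε 1 ≤ Subalgebra.toSubmodule (Algebra.adjoin ℂ {envC ε}) := by
  refine Submodule.span_le.2 ?_
  rintro _ ⟨l, ⟨h0, hl⟩, rfl⟩
  change word ε l ∈ Algebra.adjoin ℂ {envC ε}
  induction l with
  | nil => exact one_mem _
  | cons a l ih =>
    rw [word_cons]
    cases a with
    | C => exact mul_mem (Algebra.subset_adjoin rfl) (ih h0 hl)
    | L m => simp [weight] at hl
    | H m => simp [weight] at hl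
    | G k => simp [oddCount] at h0

theorem exists_mem_evenFiltration {z : (qAlgebra ε).Enveloping}
    (hz : z ∈ Submodule.span ℂ (word ε '' {l | oddCount l = 0})) :
    ∃ d, z ∈ evenFiltration ε d := by
  induction hz using Submodule.span_induction with
  | zero => exact ⟨0, zero_mem _⟩
  | add x y _ _ hx hy =>
    obtain ⟨d, hd⟩ := hx
    obtain ⟨e, he⟩ := hy
    exact ⟨max d e, add_mem (evenFiltration_mono (le_max_left _ _) hd)
      (evenFiltration_mono (le_max_right _ _) he)⟩
  | smul t x _ hx =>
    obtain ⟨d, hd⟩ := hx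
    exact ⟨d, Submodule.smul_mem _ t hd⟩
  | mem x hx =>
    obtain ⟨l, h0, rfl⟩ := hx
    exact ⟨weight l + 1, word_mem_evenFiltration h0 (Nat.lt_succ_self _)⟩

end QIndex

/-! ### Representations by differential operators on a polynomial ring. -/

/-- Labels of the variables of a polynomial ring on which `𝔮_ε` acts. -/
inductive FockVar : Type
  | x (s k : ℤ)
  | u (k : ℤ)
  | w (k : ℤ)
  | c

namespace QIndex

open MvPolynomial FockVar

/-- The polynomial ring on which `𝔮_ε` acts. -/
abbrev Fock : Type := MvPolynomial FockVar ℂ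

/-- The values on the variables of the derivations through which `L_m` and `H_m` act. -/
noncomputable def vectorFieldVar (ε : ℂ) : QIndex → FockVar → Fock
  | L m, x s k => ((k : ℂ) + s + ε - m / 2) • X (x s (m + k))
  | L m, u k => (k : ℂ) • X (u (m + k)) +
      algebraMap ℂ Fock (if m + k = 0 then ((m : ℂ) ^ 2 + m) / 24 else 0)
  | L m, w k => (k : ℂ) • X (w (m + k))
  | H m, x s k => X (x s (m + k))
  | H m, w k => algebraMap ℂ Fock (if m + k = 0 then (m : ℂ) / 6 else 0)
  | _, _ => 0

/-- The derivations through which `L_m` and `H_m` act; they are zero for `C` and `G_r`. -/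
noncomputable def vectorField (ε : ℂ) (a : QIndex) : Derivation ℂ Fock Fock :=
  mkDerivation ℂ (vectorFieldVar ε a)

theorem vectorField_X (ε : ℂ) (a : QIndex) (v : FockVar) :
    vectorField ε a (X v) = vectorFieldVar ε a v :=
  mkDerivation_X _ _ _

/-- The zeroth order terms of the action of the even part of `𝔮_ε`. -/
noncomputable def potential : QIndex → Fock
  | L m => ((m : ℂ) + 1) • (X c * X (u m))
  | H m => X c * X (w m)
  | C => X c
  | G _ => 0

theorem vectorField_C (ε : ℂ) : vectorField ε C = 0 := by
  refine derivation_ext fun v => ?_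
  rw [vectorField_X]
  rfl

/-- The vector fields have no central term: `C` gives the zero field. On the `u` and `w` variables
the action is affine, and its constants satisfy the cocycle identity. -/
theorem lie_vectorField (ε : ℂ) {a b : QIndex} (ha : parity a = 0) (hb : parity b = 0) :
    ⁅vectorField ε a, vectorField ε b⁆ =
      Finsupp.linearCombination ℂ (vectorField ε) (bracket ε a b) := by
  refine derivation_ext fun v => ?_
  rw [Derivation.commutator_apply]
  cases a <;> cases b <;> first
    | exact absurd ha (parity_G_ne_zero _)
    | exact absurd hb (parity_G_ne_zero _)
    | skip
  all_goals
    cases v <;>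
    simp only [vectorField_X, vectorFieldVar, bracket, map_add, Derivation.map_smul, map_neg, map_zero,
      Finsupp.linearCombination_single, Derivation.smul_apply,
      Derivation.neg_apply, vectorField_C, smul_zero, Derivation.zero_apply,
      Derivation.map_algebraMap, sub_self, add_zero, sub_zero, zero_sub]
  all_goals
    simp only [Algebra.algebraMap_eq_smul_one, Int.add_left_comm, Int.add_comm, neg_zero]
    try push_cast
  case L.L.u m n k =>
    by_cases h : m + (n + k) = 0
    · obtain rfl : k = -(m + n) := by omega
      simp only [h, if_true]
      push_cast
      module
    · simp only [h, if_false]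
      module
  case L.H.w m n k =>
    by_cases h : m + (n + k) = 0
    · obtain rfl : k = -(m + n) := by omega
      simp only [h, if_true]
      push_cast
      module
    · simp only [h, if_false]
      module
  case H.L.w m n k =>
    by_cases h : m + (n + k) = 0
    · obtain rfl : k = -(m + n) := by omega
      simp only [h, if_true]
      push_cast
      module
    · simp only [h, if_false]
      module
  all_goals module

/-- The auxiliary variables `u`, `w` turn the central cocycle into a coboundary. The linear parts
match by `n(n+1) - m(m+1) = (n-m)(m+n+1)`. At `n = -m` the constants `(m²+m)/24` add up to
`(n³-n)/12`, and `m/6 - n/6 = m/3`. -/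
theorem vectorField_potential_sub (ε : ℂ) {a b : QIndex} (ha : parity a = 0)
    (hb : parity b = 0) :
    vectorField ε a (potential b) - vectorField ε b (potential a) =
      Finsupp.linearCombination ℂ potential (bracket ε a b) := by
  cases a <;> cases b <;> first
    | exact absurd ha (parity_G_ne_zero _)
    | exact absurd hb (parity_G_ne_zero _)
    | skip
  all_goals
    simp only [potential, Derivation.map_smul, Derivation.leibniz, vectorField_X,
      vectorFieldVar, bracket, map_add, map_neg, map_zero, Finsupp.linearCombination_single,
      smul_zero, add_zero, sub_self, Algebra.algebraMap_eq_smul_one, smul_add, smul_eq_mul, mul_add,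
      mul_smul_comm, mul_one, mul_zero, sub_zero, zero_sub, Int.add_comm]
  case L.L m n =>
    by_cases h : m + n = 0
    · obtain rfl : n = -m := by omega
      simp only [h, if_true]
      push_cast
      module
    · simp only [h, if_false]
      push_cast
      module
  case H.H m n =>
    by_cases h : m + n = 0
    · obtain rfl : n = -m := by omega
      simp only [h, if_true]
      push_cast
      module
    · simp only [h, if_false]
      module

/-- Multiplication operators. -/
noncomputable def mulOp : Fock →ₐ[ℂ] Module.End ℂ Fock := Algebra.lmul ℂ Fock

theorem mulOp_apply (f g : Fock) : mulOp f g = f * g := rfl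

theorem mulOp_injective : Function.Injective mulOp := fun f g h => by
  simpa [mulOp_apply] using congrArg (fun T : Module.End ℂ Fock => T 1) h

/-- The action of the even basis vectors by differential operators of order at most one. -/
noncomputable def evenOp (ε : ℂ) (a : QIndex) : Module.End ℂ Fock :=
  (vectorField ε a : Fock →ₗ[ℂ] Fock) + mulOp (potential a)

theorem evenOp_apply (ε : ℂ) (a : QIndex) (f : Fock) :
    evenOp ε a f = vectorField ε a f + potential a * f := rfl

theorem evenOp_C (ε : ℂ) : evenOp ε C = mulOp (X c) := by
  refine LinearMap.ext fun f => ?_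
  simp [evenOp_apply, vectorField_C, potential, mulOp_apply]

theorem evenOp_G (ε : ℂ) (k : ℤ) : evenOp ε (G k) = 0 := by
  have h : vectorField ε (G k) = 0 := derivation_ext fun v => by rw [vectorField_X]; rfl
  refine LinearMap.ext fun f => ?_
  simp [evenOp_apply, h, potential]

theorem evenOp_mul_mulOp (ε : ℂ) (a : QIndex) (f : Fock) :
    evenOp ε a * mulOp f - mulOp f * evenOp ε a = mulOp (vectorField ε a f) := by
  refine LinearMap.ext fun g => ?_
  simp only [LinearMap.sub_apply, Module.End.mul_apply, mulOp_apply, evenOp_apply,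
    Derivation.leibniz, smul_eq_mul]
  ring

theorem linearCombination_evenOp (ε : ℂ) (v : QIndex →₀ ℂ) :
    Finsupp.linearCombination ℂ (evenOp ε) v =
      (Finsupp.linearCombination ℂ (vectorField ε) v : Fock →ₗ[ℂ] Fock) +
        mulOp (Finsupp.linearCombination ℂ potential v) := by
  induction v using Finsupp.induction_linear with
  | zero => simp
  | add v w hv hw =>
    simp only [map_add, hv, hw, Derivation.coe_add_linearMap]
    abel
  | single a t => simp [evenOp]

theorem evenOp_mul_sub (ε : ℂ) {a b : QIndex} (ha : parity a = 0) (hb : parity b = 0) :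
    evenOp ε a * evenOp ε b - evenOp ε b * evenOp ε a =
      Finsupp.linearCombination ℂ (evenOp ε) (bracket ε a b) := by
  rw [linearCombination_evenOp, ← lie_vectorField ε ha hb, ← vectorField_potential_sub ε ha hb]
  refine LinearMap.ext fun g => ?_
  simp only [LinearMap.sub_apply, LinearMap.add_apply, Module.End.mul_apply, mulOp_apply,
    evenOp_apply, Derivation.leibniz, smul_eq_mul, map_add, Derivation.coeFn_coe,
    Derivation.commutator_apply]
  ring

theorem evenOp_rel (ε : ℂ) (a b : QIndex) :
    evenOp ε a * evenOp ε b =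
      (-1 : ℂ) ^ ((parity a).val * (parity b).val) • (evenOp ε b * evenOp ε a) +
        Finsupp.linearCombination ℂ (evenOp ε) (bracket ε a b) := by
  by_cases h : parity a = 0 ∧ parity b = 0
  · rw [← evenOp_mul_sub ε h.1 h.2, h.1, ZMod.val_zero, zero_mul, pow_zero, one_smul,
      add_sub_cancel]
  · cases a <;> cases b <;> first
      | exact absurd ⟨rfl, rfl⟩ h
      | simp [evenOp_G, bracket]

/-- The representation of `U(𝔮_ε)` by differential operators in which the `G_r` act as zero. -/
theorem exists_evenRep (ε : ℂ) :
    ∃ F : (qAlgebra ε).Enveloping →ₐ[ℂ] Module.End ℂ Fock, ∀ a, F (gen ε a) = evenOp ε a :=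
  exists_algHom _ (evenOp_rel ε)

/-- The multiplication operators through which the `G_r` act. -/
noncomputable def oddOp (s : ℤ) : QIndex → Module.End ℂ Fock
  | G k => mulOp (X (x s (k - s)))
  | _ => 0

/-- The variable `x s (k - s)` transforms like `G k`: the `s` in the coefficient of the vector field
undoes the shift of the index. -/
theorem evenOp_mul_oddOp (ε : ℂ) (s : ℤ) {a : QIndex} (ha : parity a = 0) (k : ℤ) :
    evenOp ε a * oddOp s (G k) - oddOp s (G k) * evenOp ε a =
      Finsupp.linearCombination ℂ (oddOp s) (bracket ε a (G k)) := by
  rw [oddOp, evenOp_mul_mulOp, vectorField_X]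
  cases a with
  | G k => exact absurd ha (parity_G_ne_zero _)
  | L m =>
    simp only [bracket, Finsupp.linearCombination_single, oddOp, vectorFieldVar, map_smul]
    rw [add_sub_assoc m k s]
    congr 1
    push_cast
    ring
  | H m =>
    simp only [bracket, Finsupp.linearCombination_single, oddOp, vectorFieldVar, one_smul]
    rw [add_sub_assoc m k s]
  | C => simp [bracket, vectorFieldVar]

/-- This is the nilpotent component of the defining relations for the dual number representation.
Products of two odd operators do not occur, since the dual number unit squares to zero. -/
theorem oddOp_rel (ε : ℂ) (s : ℤ) (a b : QIndex) :
    evenOp ε a * oddOp s b + oddOp s a * evenOp ε b =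
      (-1 : ℂ) ^ ((parity a).val * (parity b).val) •
        (evenOp ε b * oddOp s a + oddOp s b * evenOp ε a) +
        Finsupp.linearCombination ℂ (oddOp s) (bracket ε a b) := by
  have hL (a : QIndex) (ha : parity a = 0) (k : ℤ) := evenOp_mul_oddOp ε s ha k
  have h0 (a : QIndex) (ha : parity a = 0) : oddOp s a = 0 := by
    cases a <;> first | rfl | exact absurd ha (parity_G_ne_zero _)
  by_cases ha : parity a = 0
  · by_cases hb : parity b = 0
    · rw [h0 a ha, h0 b hb]
      cases a <;> cases b <;> first
        | exact absurd ha (parity_G_ne_zero _)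
        | exact absurd hb (parity_G_ne_zero _)
        | simp [bracket, oddOp]
    · cases b <;> first
        | exact absurd rfl hb
        | rw [← hL a ha, h0 a ha, ha]
          simp
  · cases a <;> first
      | exact absurd rfl ha
      | skip
    rename_i k
    by_cases hb : parity b = 0
    · rw [h0 b hb, hb]
      have h := hL b hb k
      have h2 : Finsupp.linearCombination ℂ (oddOp s) (bracket ε (G k) b) =
          -Finsupp.linearCombination ℂ (oddOp s) (bracket ε b (G k)) := by
        rw [bracket_skew, hb]
        simp
      rw [h2, ← h]
      simp
    · cases b <;> first
        | exact absurd rfl hb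
        | simp [evenOp_G, bracket]

/-- The representation of `U(𝔮_ε)` over the dual numbers, in which `G_r` is the dual number unit
times multiplication by a variable. -/
theorem exists_dualRep (ε : ℂ) (s : ℤ) :
    ∃ F : (qAlgebra ε).Enveloping →ₐ[ℂ] DualNumber (Module.End ℂ Fock), ∀ a, F (gen ε a) =
      TrivSqZeroExt.inl (evenOp ε a) + TrivSqZeroExt.inr (oddOp s a) := by
  refine exists_algHom _ fun a b => ?_
  have h (v : QIndex →₀ ℂ) : Finsupp.linearCombination ℂ (fun a =>
      (TrivSqZeroExt.inl (evenOp ε a) + TrivSqZeroExt.inr (oddOp s a) :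
        DualNumber (Module.End ℂ Fock))) v =
      TrivSqZeroExt.inl (Finsupp.linearCombination ℂ (evenOp ε) v) +
        TrivSqZeroExt.inr (Finsupp.linearCombination ℂ (oddOp s) v) := by
    induction v using Finsupp.induction_linear with
    | zero => simp
    | add v w hv hw =>
      simp only [map_add, hv, hw, TrivSqZeroExt.inl_add, TrivSqZeroExt.inr_add]
      abel
    | single a t => simp [TrivSqZeroExt.inl_smul]
  rw [h]
  refine TrivSqZeroExt.ext ?_ ?_
  · simpa using evenOp_rel ε a b
  · simpa using oddOp_rel ε s a b

end QIndex

/-! ### Iterated commutators, principal symbols and the weight descent. -/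

namespace QIndex

open MvPolynomial FockVar

/-- The commutator with a multiplication operator. -/
noncomputable def commMul (y : Fock) : Module.End ℂ (Module.End ℂ Fock) :=
  LinearMap.mulRight ℂ (mulOp y) - LinearMap.mulLeft ℂ (mulOp y)

theorem commMul_apply (y : Fock) (A : Module.End ℂ Fock) :
    commMul y A = A * mulOp y - mulOp y * A := rfl

theorem commMul_mulOp (y f : Fock) : commMul y (mulOp f) = 0 := by
  rw [commMul_apply, ← map_mul, ← map_mul, mul_comm, sub_self]

theorem commMul_mul (y : Fock) (A B : Module.End ℂ Fock) :
    commMul y (B * A) = B * commMul y A + commMul y B * A := by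
  simp only [commMul_apply, mul_sub, sub_mul, mul_assoc]
  abel

theorem commMul_evenOp (ε : ℂ) (y : Fock) (a : QIndex) :
    commMul y (evenOp ε a) = mulOp (vectorField ε a y) :=
  evenOp_mul_mulOp ε a y

theorem commMul_pow_mulOp_mul (y f : Fock) (A : Module.End ℂ Fock) (n : ℕ) :
    (commMul y ^ n) (mulOp f * A) = mulOp f * (commMul y ^ n) A := by
  induction n with
  | zero => rfl
  | succ n ih =>
    rw [pow_succ', Module.End.mul_apply, ih, commMul_mul, commMul_mulOp, zero_mul, add_zero,
      Module.End.mul_apply]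

/-- In the Leibniz formula only two terms survive, because a second commutator kills the
multiplication operator `commMul y B`. -/
theorem commMul_pow_succ_mul {y v : Fock} {B : Module.End ℂ Fock} (hB : commMul y B = mulOp v)
    (A : Module.End ℂ Fock) (n : ℕ) :
    (commMul y ^ (n + 1)) (B * A) =
      B * (commMul y ^ (n + 1)) A + ((n : ℂ) + 1) • (mulOp v * (commMul y ^ n) A) := by
  induction n with
  | zero => simp [commMul_mul, hB]
  | succ n ih =>
    rw [pow_succ', Module.End.mul_apply, ih, map_add, map_smul, commMul_mul, commMul_mul, hB,
      commMul_mulOp, zero_mul, add_zero, ← Module.End.mul_apply, ← Module.End.mul_apply,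
      ← pow_succ', ← pow_succ', Nat.cast_add, Nat.cast_one, add_assoc]
    congr 1
    module

/-- The principal symbols, at the covector `dy`, of the operators `evenOp`. -/
noncomputable def symbol (ε : ℂ) (y : Fock) : QIndex → Fock
  | C => X c
  | a => vectorField ε a y

/-- Each factor `L_m` or `H_m` must absorb exactly one commutator, and the factorial counts the ways
to assign them. Factors `C` act by multiplication and absorb none. -/
theorem commMul_pow_weight {ε : ℂ} {F : (qAlgebra ε).Enveloping →ₐ[ℂ] Module.End ℂ Fock}
    (hF : ∀ a, F (gen ε a) = evenOp ε a) (y : Fock) {l : List QIndex} (hl : oddCount l = 0) :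
    (commMul y ^ weight l) (F (word ε l)) =
      ((weight l).factorial : ℂ) • mulOp (l.map (symbol ε y)).prod := by
  induction l with
  | nil => simp [weight, word_nil]
  | cons a l ih =>
    rw [word_cons, map_mul, hF, List.map_cons, List.prod_cons]
    have key (h : oddCount l = 0) (hs : symbol ε y a = vectorField ε a y) :
        (commMul y ^ (weight l + 1)) (evenOp ε a * F (word ε l)) =
          ((weight l + 1).factorial : ℂ) • mulOp (symbol ε y a * (l.map (symbol ε y)).prod) := by
      -- One commutator more than the weight: the multiplication operator already reached is killed.
      have h2 : (commMul y ^ (weight l + 1)) (F (word ε l)) = 0 := by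
        rw [pow_succ', Module.End.mul_apply, ih h, map_smul, commMul_mulOp, smul_zero]
      rw [commMul_pow_succ_mul (commMul_evenOp ε y a), h2, ih h, mul_zero, zero_add,
        mul_smul_comm, smul_smul, ← map_mul, hs, Nat.factorial_succ]
      push_cast
      rfl
    cases a with
    | L m => exact key hl rfl
    | H m => exact key hl rfl
    | G k => simp [oddCount] at hl
    | C =>
      change (commMul y ^ weight l) (evenOp ε C * F (word ε l)) =
        ((weight l).factorial : ℂ) • mulOp (X c * (l.map (symbol ε y)).prod)
      rw [evenOp_C, commMul_pow_mulOp_mul, ih hl, mul_smul_comm, map_mul]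

theorem commMul_pow_eq_zero {ε : ℂ} {F : (qAlgebra ε).Enveloping →ₐ[ℂ] Module.End ℂ Fock}
    (hF : ∀ a, F (gen ε a) = evenOp ε a) (y : Fock) {d : ℕ} {z : (qAlgebra ε).Enveloping}
    (hz : z ∈ evenFiltration ε d) : (commMul y ^ d) (F z) = 0 := by
  induction hz using Submodule.span_induction with
  | zero => simp
  | add a b _ _ ha hb => rw [map_add, map_add, ha, hb, add_zero]
  | smul t a _ ha => rw [map_smul, map_smul, ha, smul_zero]
  | mem a ha =>
    obtain ⟨l, ⟨h0, hl⟩, rfl⟩ := ha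
    obtain ⟨k, rfl⟩ := Nat.exists_eq_add_of_lt hl
    rw [show weight l + k + 1 = k + 1 + weight l by ring, pow_add, Module.End.mul_apply,
      commMul_pow_weight hF y h0, map_smul, pow_succ, Module.End.mul_apply, commMul_mulOp,
      map_zero, smul_zero]

/-- The covector direction at which the symbols are algebraically independent. -/
noncomputable def direction : Fock := X (x 0 0) + X (x 1 0)

/-- A map that sends the symbols to the variables of a polynomial ring. -/
noncomputable def straighten (ε : ℂ) : Fock →ₐ[ℂ] MvPolynomial QIndex ℂ :=
  aeval fun v => match v with
    | x s m => if s = 0 then X (H m) - (X (L m) - (ε - m / 2) • X (H m))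
        else X (L m) - (ε - m / 2) • X (H m)
    | c => X C
    | _ => 0

/-- The symbols of `H_m` and `L_m` are `x_{0,m} + x_{1,m}` and `(ε - m/2) x_{0,m} + (1 + ε - m/2)
x_{1,m}`, a linear system of determinant one that `straighten` inverts. A single copy `s` would make
the two symbols proportional, which is why `direction` uses two. -/
theorem straighten_symbol (ε : ℂ) {a : QIndex} (ha : parity a = 0) :
    straighten ε (symbol ε direction a) = X a := by
  cases a with
  | L m =>
    simp only [symbol, direction, map_add, vectorField_X, vectorFieldVar, map_smul]
    simp only [straighten, aeval_X, if_true, if_false, one_ne_zero, add_zero]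
    push_cast
    module
  | H m =>
    simp only [symbol, direction, map_add, vectorField_X, vectorFieldVar]
    simp [straighten]
  | G k => exact absurd ha (parity_G_ne_zero _)
  | C => simp [symbol, straighten]

theorem straighten_prod_symbol (ε : ℂ) {l : List QIndex} (hl : oddCount l = 0) :
    straighten ε (l.map (symbol ε direction)).prod = (l.map X).prod := by
  induction l with
  | nil => simp
  | cons a l ih =>
    have h : parity a = 0 ∧ oddCount l = 0 := by
      cases a <;> simp_all [parity, oddCount]
    rw [List.map_cons, List.prod_cons, map_mul, straighten_symbol ε h.1, ih h.2, List.map_cons,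
      List.prod_cons]

theorem linearIndependent_multiset_prod_X (σ : Type*) :
    LinearIndependent ℂ fun s : Multiset σ => (s.map (X : σ → MvPolynomial σ ℂ)).prod := by
  classical
  have h := (basisMonomials σ ℂ).linearIndependent.comp Multiset.toFinsupp
    Multiset.toFinsupp.injective
  have e : (fun s : Multiset σ => (s.map (X : σ → MvPolynomial σ ℂ)).prod) =
      basisMonomials σ ℂ ∘ Multiset.toFinsupp := by
    funext s
    induction s using Multiset.induction_on with
    | empty => simp
    | cons a s ih =>
      rw [Multiset.map_cons, Multiset.prod_cons, ih, ← Multiset.singleton_add, Function.comp_apply,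
        Function.comp_apply, map_add]
      simp [X, monomial_mul]
  rw [e]
  exact h

/-- The operator computes the symbol of the weight `d` part of `z`. Algebraic independence of the
symbols makes every coefficient of that part zero, leaving only lower weight. -/
theorem mem_evenFiltration_of_commMul {ε : ℂ}
    {F : (qAlgebra ε).Enveloping →ₐ[ℂ] Module.End ℂ Fock}
    (hF : ∀ a, F (gen ε a) = evenOp ε a) {d : ℕ} {z : (qAlgebra ε).Enveloping}
    (hz : z ∈ evenFiltration ε (d + 1)) (h : (commMul direction ^ d) (F z) = 0) :
    z ∈ evenFiltration ε d := by
  obtain ⟨t, ht, r, hr, rfl⟩ := Submodule.mem_sup.1 (evenFiltration_succ_le d hz)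
  obtain ⟨f, hf, rfl⟩ := (Finsupp.mem_span_image_iff_linearCombination ℂ).1 ht
  rw [map_add, map_add, commMul_pow_eq_zero hF _ hr, add_zero] at h
  have key : (commMul direction ^ d) (F (Finsupp.linearCombination ℂ (multisetWord ε) f)) =
      (d.factorial : ℂ) • mulOp (Finsupp.linearCombination ℂ
        (fun s : Multiset QIndex => (s.toList.map (symbol ε direction)).prod) f) := by
    simp only [Finsupp.linearCombination_apply, Finsupp.sum, map_sum, Finset.smul_sum, map_smul]
    refine Finset.sum_congr rfl fun s hs => ?_
    obtain ⟨h0, rfl⟩ := hf hs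
    rw [multisetWord, commMul_pow_weight hF _ h0, smul_comm]
  rw [h, eq_comm, smul_eq_zero_iff_right (Nat.cast_ne_zero.2 d.factorial_ne_zero)] at key
  have h2 := congrArg (straighten ε) (mulOp_injective (key.trans (map_zero mulOp).symm))
  have h3 : Finsupp.linearCombination ℂ
      (fun s : Multiset QIndex => (s.map (X : QIndex → MvPolynomial QIndex ℂ)).prod) f = 0 := by
    rw [← map_zero (straighten ε), ← h2]
    simp only [Finsupp.linearCombination_apply, Finsupp.sum, map_sum, map_smul]
    refine Finset.sum_congr rfl fun s hs => ?_
    rw [straighten_prod_symbol ε (hf hs).1, ← Multiset.prod_coe, ← Multiset.map_coe,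
      Multiset.coe_toList]
  rw [linearIndependent_iff.1 (linearIndependent_multiset_prod_X QIndex) f h3, map_zero, zero_add]
  exact hr

theorem dualRep_eq_inl {ε : ℂ} {s : ℤ}
    {F : (qAlgebra ε).Enveloping →ₐ[ℂ] Module.End ℂ Fock}
    (hF : ∀ a, F (gen ε a) = evenOp ε a)
    {Φ : (qAlgebra ε).Enveloping →ₐ[ℂ] DualNumber (Module.End ℂ Fock)}
    (hΦ : ∀ a, Φ (gen ε a) = TrivSqZeroExt.inl (evenOp ε a) + TrivSqZeroExt.inr (oddOp s a))
    {z : (qAlgebra ε).Enveloping}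
    (hz : z ∈ Submodule.span ℂ (word ε '' {l | oddCount l = 0})) :
    Φ z = TrivSqZeroExt.inl (F z) := by
  induction hz using Submodule.span_induction with
  | zero => simp
  | add a b _ _ ha hb => rw [map_add, map_add, ha, hb, TrivSqZeroExt.inl_add]
  | smul t a _ ha => rw [map_smul, map_smul, ha, TrivSqZeroExt.inl_smul]
  | mem a ha =>
    obtain ⟨l, hl, rfl⟩ := ha
    change oddCount l = 0 at hl
    induction l with
    | nil => simp [word_nil]
    | cons a l ih =>
      have h : oddOp s a = 0 ∧ oddCount l = 0 := by
        cases a <;> simp_all [oddOp, oddCount]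
      rw [word_cons, map_mul, map_mul, ih h.2, hΦ, hF, h.1, TrivSqZeroExt.inr_zero, add_zero,
        TrivSqZeroExt.inl_mul]

theorem commMul_eq_zero_of_commute_G {ε : ℂ}
    {F : (qAlgebra ε).Enveloping →ₐ[ℂ] Module.End ℂ Fock}
    (hF : ∀ a, F (gen ε a) = evenOp ε a) {z : (qAlgebra ε).Enveloping}
    (hz : z ∈ Submodule.span ℂ (word ε '' {l | oddCount l = 0}))
    (h : ∀ k, z * gen ε (G k) = gen ε (G k) * z) : commMul direction (F z) = 0 := by
  have key (s : ℤ) : F z * mulOp (X (x s 0)) = mulOp (X (x s 0)) * F z := by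
    obtain ⟨Φ, hΦ⟩ := exists_dualRep ε s
    have h1 := dualRep_eq_inl hF hΦ hz
    -- The choice `k = s` is the one for which `G k` acts through `x s 0`, a summand of `direction`
    -- when `s` is 0 or 1.
    have h2 := congrArg (fun u => TrivSqZeroExt.snd (Φ u)) (h s)
    simpa [h1, hΦ, evenOp_G, oddOp] using h2
  rw [commMul_apply, direction, map_add, mul_add, add_mul, key, key, sub_self]

end QIndex

/-! ### The center and the supercenter. -/

namespace QIndex

theorem transcendental_envC (ε : ℂ) : Transcendental ℂ (envC ε) := by
  obtain ⟨F, hF⟩ := exists_evenRep ε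
  rw [transcendental_iff]
  intro p hp
  have h := congrArg F hp
  rw [map_zero, ← Polynomial.aeval_algHom_apply, ← gen_C, hF, evenOp_C,
    Polynomial.aeval_algHom_apply] at h
  exact transcendental_iff.1 (MvPolynomial.transcendental_X ℂ FockVar.c) p
    (mulOp_injective (h.trans (map_zero mulOp).symm))

theorem mem_adjoin_of_commute {ε : ℂ} {z : (qAlgebra ε).Enveloping}
    (h : ∀ a, z * gen ε a = gen ε a * z) : z ∈ Algebra.adjoin ℂ {envC ε} := by
  obtain ⟨F, hF⟩ := exists_evenRep ε
  have hz := mem_span_of_commute_H_zero (h (H 0))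
  have h0 := commMul_eq_zero_of_commute_G hF hz fun k => h (G k)
  obtain ⟨d, hd⟩ := exists_mem_evenFiltration hz
  refine evenFiltration_one_le ?_
  induction d with
  | zero => exact evenFiltration_mono zero_le_one hd
  | succ d ih =>
    -- The descent must stop at level one, where the weight is zero: a further step would use the
    -- zeroth power of the commutator, that is, `F z = 0`.
    rcases d with _ | d
    · exact hd
    · refine ih (mem_evenFiltration_of_commMul hF hd ?_)
      rw [pow_succ, Module.End.mul_apply, h0, map_zero]

theorem center_eq (ε : ℂ) :
    Subalgebra.center ℂ (qAlgebra ε).Enveloping = Algebra.adjoin ℂ {envC ε} := by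
  refine le_antisymm (fun z hz => ?_) (Algebra.adjoin_le ?_)
  · exact mem_adjoin_of_commute fun a => ((Subalgebra.mem_center_iff.1 hz) _).symm
  · rintro _ rfl
    exact envC_mem_center

theorem adjoin_envC_le_envGr (ε : ℂ) :
    Subalgebra.toSubmodule (Algebra.adjoin ℂ {envC ε}) ≤ (qAlgebra ε).envGr 0 := by
  rw [Algebra.adjoin_eq_span, Submodule.span_le]
  intro u hu
  refine Submodule.subset_span ?_
  induction hu using Submonoid.closure_induction_left with
  | one => exact .one
  | mul_left x hx y _ ih =>
    obtain rfl := hx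
    exact .mul 0 0 _ y (single_mem_gr rfl 1) ih

theorem supercenter_eq (ε : ℂ) :
    (qAlgebra ε).supercenter = Subalgebra.toSubmodule (Algebra.adjoin ℂ {envC ε}) := by
  refine le_antisymm (Submodule.span_le.2 ?_) fun z hz => Submodule.subset_span ?_
  · rintro z ⟨i, hi, h⟩
    obtain rfl | rfl : i = 0 ∨ i = 1 :=
      (by decide : ∀ i : ZMod 2, i = 0 ∨ i = 1) i
    · refine mem_adjoin_of_commute fun a => ?_
      have := h _ _ (gen_mem_envGr a)
      rwa [ZMod.val_zero, zero_mul, pow_zero, one_smul] at this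
    -- As `H_0` is even, even an odd supercentral element commutes with it without a sign.
    · have := h _ _ (gen_mem_envGr (H 0))
      rw [show parity (H 0) = 0 from rfl, ZMod.val_zero, mul_zero, pow_zero, one_smul] at this
      rw [eq_zero_of_mem_envGr_one this hi]
      exact zero_mem _
  · refine ⟨0, adjoin_envC_le_envGr ε hz, fun j u _ => ?_⟩
    have hc : z ∈ Subalgebra.center ℂ (qAlgebra ε).Enveloping := center_eq ε ▸ hz
    rw [ZMod.val_zero, zero_mul, pow_zero, one_smul]
    exact ((Subalgebra.mem_center_iff.1 hc) u).symm

end QIndex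

/-- The center of `U(𝔮_ε)` is the polynomial algebra `S(C)`: both the ordinary center and the
supercenter are the subalgebra generated by `C`, and `C` satisfies no polynomial equation. -/
theorem corollary3p6 (ε : ℂ) (hε : ε = 0 ∨ ε = 1 / 2) :
    Transcendental ℂ (envC ε) ∧
    Subalgebra.center ℂ (qAlgebra ε).Enveloping = Algebra.adjoin ℂ {envC ε} ∧
    (qAlgebra ε).supercenter = Subalgebra.toSubmodule (Algebra.adjoin ℂ {envC ε}) :=
  ⟨QIndex.transcendental_envC ε, QIndex.center_eq ε, QIndex.supercenter_eq ε⟩
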